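/- Let $F_n$ be the free group on $x_1,\ldots,x_n$, let $[F_n,F_n]$ be its commutator subgroup, and let $[F_n,F_n]^{\mathrm{ab}}$ be the abelianization of $[F_n,F_n]$. The conjugation action of $F_n$ on $[F_n,F_n]$ induces an action of $F_n$ on $[F_n,F_n]^{\mathrm{ab}}$, which factors through $F_n/[F_n,F_n] = \mathbb{Z}^n$ (the class of $x_i$ corresponding to the $i$-th basis vector) and makes $[F_n,F_n]^{\mathrm{ab}}$ into a $\mathbb{Z}[\mathbb{Z}^n]$-module. Then for all $n \geq 2$ and $k \geq 0$ there is an isomorphism of abelian groups \[ H_k(\mathbb{Z}^n; [F_n,F_n]^{\mathrm{ab}}) \cong \wedge^{k+2}\, \mathbb{Z}^n, \] where the left-hand side is group homology with coefficients in this module. In particular, $[F_n,F_n]^{\mathrm{ab}}$ is not a free $\mathbb{Z}[\mathbb{Z}^n]$-module for $n \geq 3$. -/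

import Mathlib

/-- The group `ℤ^n`, written multiplicatively. -/
abbrev IntLattice (n : ℕ) : Type := Multiplicative (Fin n → ℤ)

/-- The abelianization `F_n^{ab} → ℤ^n` taking the class of `x_i` to the basis vector `e_i`. -/
def freeAbToLattice (n : ℕ) : Abelianization (FreeGroup (Fin n)) →* IntLattice n :=
  Abelianization.lift (FreeGroup.lift fun i => Multiplicative.ofAdd (Pi.single i (1 : ℤ)))

/-- The map `ℤ^n → F_n^{ab}` taking `v` to the class of `x_1 ^ v_1 ⋯ x_n ^ v_n`. -/
def latticeToFreeAb (n : ℕ) : IntLattice n →* Abelianization (FreeGroup (Fin n)) where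
  toFun v := ∏ i, Abelianization.of (FreeGroup.of i) ^ (Multiplicative.toAdd v i)
  map_one' := by simp
  map_mul' v w := by simp [zpow_add, Finset.prod_mul_distrib]

/-- The identification `F_n / [F_n, F_n] = ℤ^n`, in which `x_i` corresponds to `e_i`. -/
def freeAbEquivLattice (n : ℕ) : Abelianization (FreeGroup (Fin n)) ≃* IntLattice n :=
  MonoidHom.toMulEquiv (freeAbToLattice n) (latticeToFreeAb n)
    (by
      ext i
      simp only [MonoidHom.comp_apply, freeAbToLattice, latticeToFreeAb, Abelianization.lift_apply_of,
        FreeGroup.lift_apply_of, MonoidHom.coe_mk, OneHom.coe_mk, toAdd_ofAdd, MonoidHom.id_apply]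
      rw [Finset.prod_eq_single i]
      · simp
      · intro j _ hj
        simp [Pi.single_eq_of_ne hj]
      · simp)
    (by
      refine MonoidHom.ext fun v => ?_
      change freeAbToLattice n (∏ i, Abelianization.of (FreeGroup.of i) ^ (Multiplicative.toAdd v i)) = v
      simp only [freeAbToLattice, map_prod, map_zpow, Abelianization.lift_apply_of,
        FreeGroup.lift_apply_of]
      apply Multiplicative.toAdd.injective
      ext j
      simp [Finset.sum_apply, Pi.single_apply])

/-- The abelianization `[F_n, F_n]^{ab}`, written additively. -/
abbrev CommFreeAb (n : ℕ) : Type :=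
  Additive (Abelianization (commutator (FreeGroup (Fin n))))

/-- The action of `F_n` on `[F_n, F_n]^{ab}` induced by conjugation `c ↦ w * c * w⁻¹`
on `[F_n, F_n]`. -/
def conjAction (n : ℕ) : Representation ℤ (FreeGroup (Fin n)) (CommFreeAb n) where
  toFun w := (MonoidHom.toAdditive
    (Abelianization.map (MulAut.conjNormal (H := commutator (FreeGroup (Fin n))) w).toMonoidHom)).toIntLinearMap
  map_one' := by
    ext x
    induction x using Additive.rec with | _ x
    induction x using QuotientGroup.induction_on with | _ c
    simp
    rfl
  map_mul' v w := by
    ext x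
    induction x using Additive.rec with | _ x
    induction x using QuotientGroup.induction_on with | _ c
    simp
    rfl

lemma conjAction_of (n : ℕ) (w : FreeGroup (Fin n)) (c : commutator (FreeGroup (Fin n))) :
    conjAction n w (Additive.ofMul (Abelianization.of c)) =
      Additive.ofMul (Abelianization.of (MulAut.conjNormal w c)) := rfl

/-- The commutator subgroup `[F_n, F_n]` acts trivially on its own abelianization. -/
lemma conjAction_eq_one (n : ℕ) (w : FreeGroup (Fin n))
    (hw : w ∈ commutator (FreeGroup (Fin n))) : conjAction n w = 1 := by
  ext x
  induction x using Additive.rec with | _ x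
  induction x using QuotientGroup.induction_on with | _ c
  change conjAction n w (Additive.ofMul (Abelianization.of c)) =
    Additive.ofMul (Abelianization.of c)
  rw [conjAction_of]
  have h : MulAut.conjNormal w c = (⟨w, hw⟩ : commutator (FreeGroup (Fin n))) * c * ⟨w, hw⟩⁻¹ := by
    ext
    simp
  rw [h]
  congr 1
  simp

/-- The action of `ℤ^n = F_n / [F_n, F_n]` on `[F_n, F_n]^{ab}` induced by the conjugation action
of `F_n`. -/
def commFreeAbRep (n : ℕ) : Representation ℤ (IntLattice n) (CommFreeAb n) :=
  (QuotientGroup.lift (commutator (FreeGroup (Fin n))) (conjAction n)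
    (conjAction_eq_one n)).comp (freeAbEquivLattice n).symm.toMonoidHom

/-- The defining property: the image in `ℤ^n` of a word `w` acts as conjugation by `w`. -/
lemma commFreeAbRep_apply (n : ℕ) (w : FreeGroup (Fin n))
    (c : commutator (FreeGroup (Fin n))) :
    commFreeAbRep n (freeAbEquivLattice n (Abelianization.of w))
        (Additive.ofMul (Abelianization.of c)) =
      Additive.ofMul (Abelianization.of (MulAut.conjNormal w c)) := by
  change QuotientGroup.lift (commutator (FreeGroup (Fin n))) (conjAction n) (conjAction_eq_one n)
    ((freeAbEquivLattice n).symm (freeAbEquivLattice n (Abelianization.of w))) _ = _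
  rw [MulEquiv.symm_apply_apply]
  exact conjAction_of n w c

/-- The image in `ℤ^n` of the generator `x_i` is the basis vector `e_i`. -/
lemma freeAbEquivLattice_of (n : ℕ) (i : Fin n) :
    freeAbEquivLattice n (Abelianization.of (FreeGroup.of i)) =
      Multiplicative.ofAdd (Pi.single i (1 : ℤ)) := by
  simp [freeAbEquivLattice, freeAbToLattice]

/-! Write R = ℤ[ℤ^n]. The cover of a wedge of n circles with group [F_n, F_n] is the Cayley graph of
ℤ^n, so [F_n, F_n]^ab is its first homology: the kernel of R^n → R, e_i ↦ x_i - 1. Algebraically,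
Fox derivatives give the map into R^n and Reidemeister-Schreier rewriting inverts it on that kernel
(`commFreeAbEquivKer`).

This map is the first differential of the Koszul complex of x_1 - 1, …, x_n - 1. The sequence is
regular (`mem_span_of_shiftElt_mul_mem`), so the complex is exact in positive degrees
(`exists_koszul`), and its terms from degree 2 on form a free resolution of the kernel. All entries
of the differentials lie in the augmentation ideal, so they vanish on coinvariants. Hence H_k is ℤ
to the rank of the Koszul term of degree k + 2, which is n.choose (k + 2), the rank of the exterior
power. `nonempty_groupHomology_ker_equiv` obtains this by dimension shifting.

A free module would have H_1 = 0, whereas ∧^3 ℤ^n ≠ 0 for n ≥ 3. -/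

open CategoryTheory Representation

/-! ### Modules over the group ring, and acyclicity of free ones -/

/-- The representation on a module over the group ring. -/
noncomputable abbrev modRep (G : Type) [Group G] (N : Type) [AddCommGroup N]
    [Module (MonoidAlgebra ℤ G) N] : Representation ℤ G N :=
  Representation.ofModule' N

section
variable {G : Type} [Group G] {N P : Type} [AddCommGroup N] [Module (MonoidAlgebra ℤ G) N]
  [AddCommGroup P] [Module (MonoidAlgebra ℤ G) P]

lemma modRep_apply (g : G) (x : N) : modRep G N g x = MonoidAlgebra.single g (1 : ℤ) • x := by
  simp [modRep, Representation.ofModule']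

/-- A linear map over the group ring as an intertwining map. -/
noncomputable def modRepMap (f : N →ₗ[MonoidAlgebra ℤ G] P) : (modRep G N).IntertwiningMap (modRep G P) :=
  LinearMap.intertwiningMap_of_isIntertwiningMap _ _ f.toAddMonoidHom.toIntLinearMap
    fun g v => by
      simp only [modRep_apply]
      exact f.map_smul _ _

lemma modRepMap_apply (f : N →ₗ[MonoidAlgebra ℤ G] P) (x : N) : modRepMap f x = f x := rfl

/-- A linear equivalence over the group ring as an isomorphism of representations. -/
noncomputable def modRepIso (e : N ≃ₗ[MonoidAlgebra ℤ G] P) :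
    Rep.of (modRep G N) ≅ Rep.of (modRep G P) :=
  Rep.mkIso (Representation.Equiv.mk e.toAddEquiv.toIntLinearEquiv fun g => by
    ext v
    simp [modRep_apply])

/-- A representation agrees with the one obtained from its associated module. -/
noncomputable def asModuleRepIso {V : Type} [AddCommGroup V] (ρ : Representation ℤ G V) :
    Rep.of ρ ≅ Rep.of (modRep G ρ.asModule) :=
  Rep.mkIso (Representation.Equiv.mk ρ.asModuleEquiv.toAddEquiv.symm.toIntLinearEquiv fun g => by
    ext v
    simp [modRep_apply]
    rfl)

/-- The equivariant map from the representation induced from the trivial subgroup to the free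
representation. -/
noncomputable def indToFree (α : Type) :
    (Representation.ind (⊥ : Subgroup G).subtype
      (Representation.trivial ℤ (⊥ : Subgroup G) (α →₀ ℤ))).IntertwiningMap
      (Representation.free ℤ G α) :=
  -- Frobenius reciprocity applied to the inclusion of coefficients at the identity of `G`.
  ((Rep.indResHomEquiv (⊥ : Subgroup G).subtype
      (Rep.trivial ℤ (⊥ : Subgroup G) (α →₀ ℤ)) (Rep.free ℤ G α)).symm
      (Rep.ofHom (LinearMap.intertwiningMap_of_isIntertwiningMap _ _
        (Finsupp.mapRange.linearMap (MonoidAlgebra.lsingle (1 : G))) fun g v => by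
          obtain rfl : g = 1 := Subsingleton.elim _ _
          simp))).hom

/-- The free representation is induced from the trivial subgroup. -/
noncomputable def indEquivFree (α : Type) :
    (Representation.ind (⊥ : Subgroup G).subtype
      (Representation.trivial ℤ (⊥ : Subgroup G) (α →₀ ℤ))).Equiv
      (Representation.free ℤ G α) :=
  Representation.Equiv.mk (LinearEquiv.ofLinearMap (indToFree α).toLinearMap
    (Representation.freeLift (Representation.ind (⊥ : Subgroup G).subtype
      (Representation.trivial ℤ (⊥ : Subgroup G) (α →₀ ℤ)))
      fun i => IndV.mk _ _ 1 (Finsupp.single i 1)).toLinearMap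
    (by ext; simp [indToFree])
    (by ext; simp [indToFree]; exact one_smul ..))
    fun g => by
      ext; simp [indToFree]

/-- A free module is induced from the trivial subgroup, so Shapiro's lemma reduces its homology to
that of the trivial group. -/
lemma isZero_groupHomology_of_basis {β : Type} (b : Module.Basis β (MonoidAlgebra ℤ G) N) (k : ℕ) :
    Limits.IsZero (groupHomology (Rep.of (modRep G N)) (k + 1)) := by
  classical
  let e : Rep.of (modRep G N) ≅ Rep.ind (⊥ : Subgroup G).subtype
      (Rep.trivial ℤ (⊥ : Subgroup G) (β →₀ ℤ)) :=
    modRepIso (b.repr ≪≫ₗ finsuppLEquivFreeAsModule ℤ G β) ≪≫ (asModuleRepIso _).symm ≪≫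
      (Rep.mkIso (indEquivFree β)).symm
  exact (isZero_groupHomology_succ_of_subsingleton
      (Rep.trivial ℤ (⊥ : Subgroup G) (β →₀ ℤ)) k).of_iso
    ((groupHomology.functor ℤ G (k + 1)).mapIso e ≪≫ groupHomology.indIso _ _ _)

end

/-! ### Exactness and degree-zero homology of representations -/

section
variable {k G : Type} [CommRing k] [Group G]

lemma Rep.shortExact_of_exact (X : ShortComplex (Rep.{0} k G)) (hi : Function.Injective X.f.hom)
    (he : ∀ x, X.g.hom x = 0 → ∃ y, X.f.hom y = x) (hs : Function.Surjective X.g.hom) :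
    X.ShortExact where
  exact := by
    refine (ShortComplex.exact_map_iff_of_faithful X
      (forget₂ (Rep.{0} k G) (ModuleCat.{0} k))).1 ((ShortComplex.moduleCat_exact_iff _).2 ?_)
    exact he
  mono_f := (Rep.mono_iff_injective _).2 hi
  epi_g := (Rep.epi_iff_surjective _).2 hs

/-- A morphism with image in the augmentation submodule induces zero on degree zero homology. -/
lemma groupHomology.functor_zero_map_eq_zero {A B : Rep.{0} k G} (f : A ⟶ B)
    (hf : ∀ x, f.hom x ∈ Coinvariants.ker B.ρ) :
    (groupHomology.functor k G 0).map f = 0 := by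
  have h : groupHomology.H0π A ≫ (groupHomology.functor k G 0).map f =
      f.toModuleCatHom ≫ groupHomology.H0π B :=
    groupHomology.H0π_comp_map (MonoidHom.id G) f
  have h1 : f.toModuleCatHom ≫ (Rep.coinvariantsMk k G).app B = 0 := by
    ext x
    exact (Coinvariants.mk_eq_zero _).2 (hf x)
  refine (cancel_epi (groupHomology.H0π A)).1 ?_
  have h2 : f.toModuleCatHom ≫ groupHomology.H0π B = 0 := by
    rw [← groupHomology.coinvariantsMk_comp_H0Iso_inv, ← Category.assoc, h1, Limits.zero_comp]
  exact (h.trans h2).trans Limits.comp_zero.symm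
end

/-! ### Augmentation, coinvariants and dimension shifting -/

section
variable {G : Type} [Group G] {N P : Type} [AddCommGroup N] [Module (MonoidAlgebra ℤ G) N]
  [AddCommGroup P] [Module (MonoidAlgebra ℤ G) P]

/-- The augmentation of the integral group ring. -/
noncomputable def augmentation (G : Type) [Group G] : MonoidAlgebra ℤ G →ₐ[ℤ] ℤ :=
  MonoidAlgebra.lift ℤ ℤ G 1

@[simp] lemma augmentation_single (g : G) (m : ℤ) :
    augmentation G (MonoidAlgebra.single g m) = m := by
  simp [augmentation]

/-- The coordinatewise augmentation on a free module. -/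
noncomputable def piAugmentation (G ι : Type) [Group G] :
    (ι → MonoidAlgebra ℤ G) →ₗ[ℤ] (ι → ℤ) :=
  LinearMap.pi fun i => (augmentation G).toLinearMap ∘ₗ LinearMap.proj i

lemma piAugmentation_apply {ι : Type} (v : ι → MonoidAlgebra ℤ G) (i : ι) :
    piAugmentation G ι v i = augmentation G (v i) := rfl

lemma piAugmentation_surjective (G ι : Type) [Group G] :
    Function.Surjective (piAugmentation G ι) := fun w =>
  ⟨fun i => MonoidAlgebra.single 1 (w i), by ext; simp [piAugmentation_apply]⟩

lemma coinvariants_mk_single {ι : Type} [DecidableEq ι] (i : ι)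
    (r : MonoidAlgebra ℤ G) :
    Coinvariants.mk (modRep G (ι → MonoidAlgebra ℤ G)) (Pi.single i r) =
      Coinvariants.mk (modRep G (ι → MonoidAlgebra ℤ G))
        (Pi.single i (MonoidAlgebra.single 1 (augmentation G r))) := by
  induction r using MonoidAlgebra.induction_linear with
  | zero => simp
  | add a b ha hb => simp [Pi.single_add, ha, hb]
  | single g m =>
    rw [augmentation_single, ← Coinvariants.mk_self_apply (modRep G (ι → MonoidAlgebra ℤ G)) g
      (Pi.single i (MonoidAlgebra.single 1 m)), modRep_apply, ← Pi.single_smul]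
    simp

/-- Modulo the elements g • v - v, each coordinate may be replaced by its augmentation
(`coinvariants_mk_single`). Thus the coinvariants of R^ι are ℤ^ι. -/
lemma ker_piAugmentation (ι : Type) [Fintype ι] :
    LinearMap.ker (piAugmentation G ι) =
      Coinvariants.ker (modRep G (ι → MonoidAlgebra ℤ G)) := by
  classical
  apply le_antisymm
  · intro v hv
    rw [← Coinvariants.mk_eq_zero, ← Finset.univ_sum_single v, map_sum]
    refine Finset.sum_eq_zero fun i _ => ?_
    have h : augmentation G (v i) = 0 := congrFun hv i
    rw [coinvariants_mk_single, h]
    simp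
  · refine Submodule.span_le.2 ?_
    rintro _ ⟨⟨g, v⟩, rfl⟩
    ext i
    simp [piAugmentation_apply, modRep_apply]

/-- For injectivity, a generator g • p - p lifts along `f` to g • y - y. An element mapping into the
augmentation submodule of `P` therefore differs from one in that of `N` by an element of ker f,
which `hker` covers. -/
lemma coinvariants_map_bijective (f : N →ₗ[MonoidAlgebra ℤ G] P) (hf : Function.Surjective f)
    (hker : ∀ x, f x = 0 → x ∈ Coinvariants.ker (modRep G N)) :
    Function.Bijective (Coinvariants.map _ _ (modRepMap f)) := by
  constructor
  · rw [← LinearMap.ker_eq_bot, LinearMap.ker_eq_bot']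
    intro x hx
    induction x using Coinvariants.induction_on with | _ x
    rw [Coinvariants.map_mk, Coinvariants.mk_eq_zero, modRepMap_apply] at hx
    rw [Coinvariants.mk_eq_zero]
    have key : Coinvariants.ker (modRep G P) ≤
        (Coinvariants.ker (modRep G N)).map (modRepMap f).toLinearMap := by
      refine Submodule.span_le.2 ?_
      rintro _ ⟨⟨g, p⟩, rfl⟩
      obtain ⟨y, rfl⟩ := hf p
      refine ⟨_, Coinvariants.sub_mem_ker g y, ?_⟩
      rw [map_sub]
      change f _ - f _ = _
      simp [modRep_apply]
    obtain ⟨y, hy, hyx⟩ := key hx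
    have h := hker (x - y) (by
      rw [map_sub, sub_eq_zero]
      exact hyx.symm)
    simpa using Submodule.add_mem _ h hy
  · intro x
    induction x using Coinvariants.induction_on with | _ x
    obtain ⟨y, rfl⟩ := hf x
    exact ⟨Coinvariants.mk _ y, rfl⟩

/-- The coinvariants of a quotient of a free module by a submodule on which the augmentation
vanishes. -/
noncomputable def coinvariantsEquiv {ι : Type} [Fintype ι]
    (f : (ι → MonoidAlgebra ℤ G) →ₗ[MonoidAlgebra ℤ G] P) (hf : Function.Surjective f)
    (hker : ∀ x, f x = 0 → piAugmentation G ι x = 0) :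
    Coinvariants (modRep G P) ≃ₗ[ℤ] (ι → ℤ) :=
  (LinearEquiv.ofBijective _ (coinvariants_map_bijective f hf fun x hx => by
    rw [← ker_piAugmentation]
    exact hker x hx)).symm ≪≫ₗ
  Submodule.quotEquivOfEq _ _ (ker_piAugmentation ι).symm ≪≫ₗ
    (piAugmentation G ι).quotKerEquivOfSurjective (piAugmentation_surjective G ι)

/-- The short complex associated with a linear map. -/
noncomputable def kerShortComplex (f : N →ₗ[MonoidAlgebra ℤ G] P) : ShortComplex (Rep ℤ G) where
  X₁ := Rep.of (modRep G (LinearMap.ker f))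
  X₂ := Rep.of (modRep G N)
  X₃ := Rep.of (modRep G P)
  f := Rep.ofHom (modRepMap (LinearMap.ker f).subtype)
  g := Rep.ofHom (modRepMap f)
  zero := by
    ext x
    exact x.2

lemma kerShortComplex_shortExact (f : N →ₗ[MonoidAlgebra ℤ G] P) (hf : Function.Surjective f) :
    (kerShortComplex f).ShortExact :=
  Rep.shortExact_of_exact _ Subtype.val_injective (fun x hx => ⟨⟨x, hx⟩, rfl⟩) hf

/-- Dimension shifting. -/
lemma nonempty_iso_ker (f : N →ₗ[MonoidAlgebra ℤ G] P) (hf : Function.Surjective f)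
    (hN : ∀ k, Limits.IsZero (groupHomology (Rep.of (modRep G N)) (k + 1)))
    (hker : ∀ x, f x = 0 → x ∈ Coinvariants.ker (modRep G N)) (k : ℕ) :
    Nonempty (groupHomology (Rep.of (modRep G P)) (k + 1) ≅
      groupHomology (Rep.of (modRep G (LinearMap.ker f))) k) := by
  have hX := kerShortComplex_shortExact f hf
  have : Mono (groupHomology.δ hX (k + 1) k rfl) := groupHomology.mono_δ_of_isZero hX k (hN k)
  -- The next map of the long exact sequence, into H_k of `N`, is zero: for k = 0 by `hker`, for k >
  -- 0 because its target vanishes.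
  have : Epi (groupHomology.δ hX (k + 1) k rfl) := by
    refine (groupHomology.mapShortComplex₁_exact hX rfl).epi_f ?_
    cases k with
    | zero => exact groupHomology.functor_zero_map_eq_zero _ fun x => hker _ x.2
    | succ k => exact (hN k).eq_of_tgt _ _
  exact ⟨@asIso _ _ _ _ _ (isIso_of_mono_of_epi (groupHomology.δ hX (k + 1) k rfl))⟩
end

/-! ### Homology from a minimal free resolution -/

section
variable {G : Type} [Group G]

/-- The homology of the syzygies of a minimal free resolution. -/
lemma nonempty_groupHomology_ker_equiv {ι : ℕ → Type} [∀ k, Fintype (ι k)]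
    (d : ∀ k, (ι (k + 1) → MonoidAlgebra ℤ G) →ₗ[MonoidAlgebra ℤ G] (ι k → MonoidAlgebra ℤ G))
    (hd : ∀ k, LinearMap.ker (d k) = LinearMap.range (d (k + 1)))
    (hmin : ∀ k x, piAugmentation G (ι k) (d k x) = 0) (k j m : ℕ) (hm : m = j + k + 2) :
    Nonempty (groupHomology (Rep.of (modRep G (LinearMap.ker (d j)))) k ≃ₗ[ℤ] (ι m → ℤ)) := by
  induction k generalizing j with
  | zero =>
    subst hm
    -- By exactness `d (j + 1)` maps onto ker (d j), with kernel the image of `d (j + 2)`;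
    -- minimality puts that kernel in the augmentation submodule.
    let f := (d (j + 1)).codRestrict (LinearMap.ker (d j)) fun x => by
      rw [hd]
      exact ⟨x, rfl⟩
    refine ⟨(groupHomology.H0Iso _).toLinearEquiv ≪≫ₗ coinvariantsEquiv f ?_ ?_⟩
    · rintro ⟨x, hx⟩
      obtain ⟨y, rfl⟩ := (hd j).le hx
      exact ⟨y, rfl⟩
    · intro x hx
      obtain ⟨y, rfl⟩ := (hd (j + 1)).le (congrArg Subtype.val hx)
      exact hmin _ y
  | succ k ih =>
    let f := (d (j + 1)).codRestrict (LinearMap.ker (d j)) fun x => by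
      rw [hd]
      exact ⟨x, rfl⟩
    have hf : Function.Surjective f := by
      rintro ⟨x, hx⟩
      obtain ⟨y, rfl⟩ := (hd j).le hx
      exact ⟨y, rfl⟩
    obtain ⟨e⟩ := nonempty_iso_ker f hf (isZero_groupHomology_of_basis (Pi.basisFun _ _))
      (fun x hx => by
        obtain ⟨y, rfl⟩ := (hd (j + 1)).le (congrArg Subtype.val hx)
        rw [← ker_piAugmentation]
        exact hmin _ y) k
    obtain ⟨e'⟩ := ih (j + 1) (by omega)
    have hfd : LinearMap.ker f = LinearMap.ker (d (j + 1)) := LinearMap.ker_codRestrict _ _ _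
    exact ⟨(e ≪≫ (groupHomology.functor ℤ G k).mapIso
      (modRepIso (LinearEquiv.ofEq _ _ hfd))).toLinearEquiv ≪≫ₗ e'⟩
end

/-! ### Fox calculus and Reidemeister-Schreier rewriting -/

section
variable {n : ℕ}

/-- The abelianization `F_n → ℤ^n`. -/
def freeToLattice (n : ℕ) : FreeGroup (Fin n) →* IntLattice n :=
  (freeAbEquivLattice n).toMonoidHom.comp Abelianization.of

@[simp] lemma freeToLattice_of (i : Fin n) :
    freeToLattice n (FreeGroup.of i) = Multiplicative.ofAdd (Pi.single i (1 : ℤ)) :=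
  freeAbEquivLattice_of n i

lemma freeToLattice_eq_one_iff (w : FreeGroup (Fin n)) :
    freeToLattice n w = 1 ↔ w ∈ commutator (FreeGroup (Fin n)) := by
  change freeAbEquivLattice n (Abelianization.of w) = 1 ↔ _
  rw [EmbeddingLike.map_eq_one_iff, ← MonoidHom.mem_ker, Abelianization.ker_of]

lemma freeToLattice_surjective (n : ℕ) : Function.Surjective (freeToLattice n) :=
  (freeAbEquivLattice n).surjective.comp QuotientGroup.mk_surjective

/-- The integral group ring of `ℤ^n`. -/
abbrev LatticeRing (n : ℕ) : Type := MonoidAlgebra ℤ (IntLattice n)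

/-- The group ring element given by the image of a word. -/
noncomputable def wordElt (w : FreeGroup (Fin n)) : LatticeRing n :=
  MonoidAlgebra.of ℤ (IntLattice n) (freeToLattice n w)

@[simp] lemma wordElt_one : wordElt (1 : FreeGroup (Fin n)) = 1 := by
  simp [wordElt, MonoidAlgebra.one_def]

@[simp] lemma wordElt_mul (v w : FreeGroup (Fin n)) :
    wordElt (v * w) = wordElt v * wordElt w := by simp [wordElt]

lemma wordElt_mul_inv (w : FreeGroup (Fin n)) : wordElt w * wordElt w⁻¹ = 1 := by
  rw [← wordElt_mul, mul_inv_cancel, wordElt_one]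

lemma wordElt_inv_mul (w : FreeGroup (Fin n)) : wordElt w⁻¹ * wordElt w = 1 := by
  rw [← wordElt_mul, inv_mul_cancel, wordElt_one]

/-- The affine action of the free group on `ℤ[ℤ^n]^n` in which `x_i` acts by
`v ↦ e_i + x_i v`. -/
noncomputable def foxAction (n : ℕ) :
    FreeGroup (Fin n) →* Equiv.Perm (Fin n → LatticeRing n) :=
  FreeGroup.lift fun i =>
    { toFun := fun v => Pi.single i 1 + wordElt (FreeGroup.of i) • v
      invFun := fun v => wordElt (FreeGroup.of i)⁻¹ • (v - Pi.single i 1)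
      left_inv := fun v => by simp [smul_smul, wordElt_inv_mul]
      right_inv := fun v => by simp [smul_smul, wordElt_mul_inv] }

/-- The Fox derivative of a word. -/
noncomputable def foxDeriv (w : FreeGroup (Fin n)) : Fin n → LatticeRing n := foxAction n w 0

/-- Each word acts by an affine map with linear part `wordElt w`; composing such maps yields the
product rule for Fox derivatives. -/
lemma foxAction_apply (w : FreeGroup (Fin n)) (v : Fin n → LatticeRing n) :
    foxAction n w v = foxDeriv w + wordElt w • v := by
  unfold foxDeriv
  induction w using FreeGroup.induction_on generalizing v with
  | C1 => simp
  | of i => simp [foxAction]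
  | inv_of i _ =>
    have h : ∀ u, foxAction n (FreeGroup.of i)⁻¹ u =
        wordElt (FreeGroup.of i)⁻¹ • (u - Pi.single i 1) := fun u => by
      simp only [foxAction, map_inv, FreeGroup.lift_apply_of]
      rfl
    rw [h, h, zero_sub, smul_sub, smul_neg]
    abel
  | mul u w hu hw =>
    rw [map_mul, Equiv.Perm.mul_apply, Equiv.Perm.mul_apply, hw, hu, hu (foxAction n w 0)]
    simp [smul_smul, add_assoc]

@[simp] lemma foxDeriv_one : foxDeriv (1 : FreeGroup (Fin n)) = 0 := by simp [foxDeriv]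

@[simp] lemma foxDeriv_of (i : Fin n) : foxDeriv (FreeGroup.of i) = Pi.single i 1 := by
  simp [foxDeriv, foxAction]

lemma foxDeriv_mul (u w : FreeGroup (Fin n)) :
    foxDeriv (u * w) = foxDeriv u + wordElt u • foxDeriv w := by
  rw [← foxAction_apply, foxDeriv, map_mul]
  rfl

lemma foxDeriv_mul_inv (u w : FreeGroup (Fin n)) (h : freeToLattice n u = freeToLattice n w) :
    foxDeriv (u * w⁻¹) = foxDeriv u - foxDeriv w := by
  have h1 := foxDeriv_mul (u * w⁻¹) w
  have h2 : wordElt (u * w⁻¹) = 1 := by simp [wordElt, h, ← MonoidAlgebra.one_def]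
  rw [inv_mul_cancel_right, h2, one_smul] at h1
  rw [h1]
  abel

lemma foxDeriv_inv (w : FreeGroup (Fin n)) :
    foxDeriv w⁻¹ = -(wordElt w⁻¹ • foxDeriv w) := by
  have h := foxDeriv_mul w⁻¹ w
  rw [inv_mul_cancel, foxDeriv_one] at h
  exact eq_neg_of_add_eq_zero_left h.symm

/-- The boundary map `ℤ[ℤ^n]^n → ℤ[ℤ^n]` sending `e_i` to `x_i - 1`. -/
noncomputable def foxBoundary (n : ℕ) : (Fin n → LatticeRing n) →ₗ[LatticeRing n] LatticeRing n :=
  Fintype.linearCombination (LatticeRing n) fun i => wordElt (FreeGroup.of i) - 1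

lemma foxBoundary_single (i : Fin n) (r : LatticeRing n) :
    foxBoundary n (Pi.single i r) = r * (wordElt (FreeGroup.of i) - 1) := by
  simp [foxBoundary, Fintype.linearCombination_apply_single]

/-- The fundamental formula of Fox calculus. -/
lemma foxBoundary_foxDeriv (w : FreeGroup (Fin n)) :
    foxBoundary n (foxDeriv w) = wordElt w - 1 := by
  induction w using FreeGroup.induction_on with
  | C1 => simp
  | of i => simp [foxBoundary_single]
  | inv_of i h =>
    rw [foxDeriv_inv, map_neg, map_smul, h, smul_eq_mul, mul_sub, wordElt_inv_mul]
    ring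
  | mul u w hu hw =>
    rw [foxDeriv_mul, map_add, map_smul, hu, hw, wordElt_mul, smul_eq_mul]
    ring

/-- The Fox derivative on the abelianized commutator subgroup. -/
noncomputable def foxHom (n : ℕ) : CommFreeAb n →+ (Fin n → LatticeRing n) :=
  MonoidHom.toAdditiveLeft (Abelianization.lift
    { toFun := fun c => Multiplicative.ofAdd (foxDeriv (c : FreeGroup (Fin n)))
      map_one' := by simp
      map_mul' := fun c c' => by
        have h : wordElt (c : FreeGroup (Fin n)) = 1 := by
          rw [wordElt, (freeToLattice_eq_one_iff _).2 c.2, map_one]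
        simp [foxDeriv_mul, h] })

/-- The class in `[F_n, F_n]^{ab}` of a word in the commutator subgroup. -/
def commClass (w : FreeGroup (Fin n)) (hw : freeToLattice n w = 1) : CommFreeAb n :=
  Additive.ofMul (Abelianization.of ⟨w, (freeToLattice_eq_one_iff w).1 hw⟩)

lemma commClass_mul (u w : FreeGroup (Fin n)) (hu : freeToLattice n u = 1)
    (hw : freeToLattice n w = 1) (huw : freeToLattice n (u * w) = 1) :
    commClass (u * w) huw = commClass u hu + commClass w hw := rfl

lemma exists_commClass (x : CommFreeAb n) : ∃ w hw, x = commClass w hw := by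
  induction x using Additive.rec with | _ x
  induction x using QuotientGroup.induction_on with | _ c
  exact ⟨c, (freeToLattice_eq_one_iff _).2 c.2, rfl⟩

@[simp] lemma foxHom_commClass (w : FreeGroup (Fin n)) (hw : freeToLattice n w = 1) :
    foxHom n (commClass w hw) = foxDeriv w := rfl

lemma commFreeAbRep_commClass (u w : FreeGroup (Fin n)) (hw : freeToLattice n w = 1)
    (h : freeToLattice n (u * w * u⁻¹) = 1) :
    commFreeAbRep n (freeToLattice n u) (commClass w hw) = commClass (u * w * u⁻¹) h :=
  commFreeAbRep_apply n u _

lemma foxHom_smul (g : IntLattice n) (x : CommFreeAb n) :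
    foxHom n (commFreeAbRep n g x) = MonoidAlgebra.single g (1 : ℤ) • foxHom n x := by
  obtain ⟨u, rfl⟩ := freeToLattice_surjective n g
  obtain ⟨w, hw, rfl⟩ := exists_commClass x
  rw [commFreeAbRep_commClass u w hw (by simp [hw]), foxHom_commClass, foxHom_commClass,
    foxDeriv_mul_inv _ _ (by simp [hw]), foxDeriv_mul]
  simp [wordElt]

lemma smul_foxHom_commFreeAbRep (m : ℤ) (g : IntLattice n) (x : CommFreeAb n) :
    m • foxHom n (commFreeAbRep n g x) = MonoidAlgebra.single g m • foxHom n x := by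
  rw [foxHom_smul, ← smul_assoc, MonoidAlgebra.smul_single, smul_eq_mul, mul_one]

/-- A set-theoretic section of the abelianization map. -/
noncomputable def latticeSection (n : ℕ) : IntLattice n → FreeGroup (Fin n) :=
  Function.surjInv (freeToLattice_surjective n)

@[simp] lemma freeToLattice_latticeSection (g : IntLattice n) :
    freeToLattice n (latticeSection n g) = g :=
  Function.surjInv_eq _ g

/-- The class of the loop based at the section over `g` traversing the word `w`. -/
noncomputable def schreierClass (g : IntLattice n) (w : FreeGroup (Fin n)) : CommFreeAb n :=
  commClass (latticeSection n g * w * (latticeSection n (g * freeToLattice n w))⁻¹) (by simp)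

/-- Concatenation of paths in the Cayley graph: the section over the intermediate vertex cancels. -/
lemma schreierClass_mul (g : IntLattice n) (u w : FreeGroup (Fin n)) :
    schreierClass g (u * w) = schreierClass g u + schreierClass (g * freeToLattice n u) w := by
  unfold schreierClass
  rw [← commClass_mul _ _ _ _ (by simp)]
  congr 1
  simp only [map_mul]
  group

lemma schreierClass_one (g : IntLattice n) : schreierClass g 1 = 0 := by
  have h := schreierClass_mul g 1 1
  simpa using h

/-- The Reidemeister-Schreier rewriting map, inverse to the Fox derivative. -/
noncomputable def schreierMap (n : ℕ) : (Fin n → LatticeRing n) →ₗ[ℤ] CommFreeAb n :=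
  ∑ i, Finsupp.linearCombination ℤ (fun g => schreierClass g (FreeGroup.of i)) ∘ₗ
    (MonoidAlgebra.coeffLinearEquiv ℤ).toLinearMap ∘ₗ LinearMap.proj i

lemma schreierMap_single (i : Fin n) (g : IntLattice n) (m : ℤ) :
    schreierMap n (Pi.single i (MonoidAlgebra.single g m)) =
      m • schreierClass g (FreeGroup.of i) := by
  rw [schreierMap, LinearMap.sum_apply, Finset.sum_eq_single i]
  · simp
  · intro j _ hj
    simp [Pi.single_eq_of_ne hj]
  · simp

/-- Both sides obey the same cocycle rule in `w` and agree on generators. -/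
lemma schreierMap_smul_foxDeriv (g : IntLattice n) (w : FreeGroup (Fin n)) :
    schreierMap n (MonoidAlgebra.single g (1 : ℤ) • foxDeriv w) = schreierClass g w := by
  induction w using FreeGroup.induction_on generalizing g with
  | C1 => simp [schreierClass_one]
  | of i =>
    rw [foxDeriv_of, ← Pi.single_smul, smul_eq_mul, mul_one, schreierMap_single, one_smul]
  | inv_of i h =>
    have h1 := schreierClass_mul g (FreeGroup.of i)⁻¹ (FreeGroup.of i)
    rw [inv_mul_cancel, schreierClass_one, ← h] at h1
    rw [foxDeriv_inv, smul_neg, map_neg, eq_neg_of_add_eq_zero_left h1.symm, smul_smul]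
    simp [wordElt]
  | mul u w hu hw =>
    rw [foxDeriv_mul, smul_add, map_add, hu, schreierClass_mul, ← hw, smul_smul]
    simp [wordElt]

lemma schreierMap_foxHom (x : CommFreeAb n) : schreierMap n (foxHom n x) = x := by
  obtain ⟨w, hw, rfl⟩ := exists_commClass x
  have h := schreierMap_smul_foxDeriv 1 w
  rw [← MonoidAlgebra.one_def, one_smul] at h
  -- The section need not send 1 to 1, but its value there lies in the commutator subgroup, which
  -- acts trivially on the abelianization.
  have h2 : commClass (latticeSection n 1 * w * (latticeSection n 1)⁻¹) (by simp [hw]) =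
      commClass w hw := by
    rw [← commFreeAbRep_commClass _ w hw, freeToLattice_latticeSection, map_one]
    rfl
  rw [foxHom_commClass, h, schreierClass]
  simp only [hw, mul_one]
  exact h2

/-- The Fox derivatives of the chosen section, extended linearly. -/
noncomputable def sectionDeriv (n : ℕ) : LatticeRing n →ₗ[ℤ] (Fin n → LatticeRing n) :=
  Finsupp.linearCombination ℤ (fun g => foxDeriv (latticeSection n g)) ∘ₗ
    (MonoidAlgebra.coeffLinearEquiv ℤ).toLinearMap

/-- On the edge g • e_i from g to g x_i, the two section paths contribute D s(g) - D s(g x_i), for D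
the Fox derivative and s the section. This correction depends only on the boundary of the edge, so
it disappears on cycles. -/
lemma foxHom_schreierMap (v : Fin n → LatticeRing n) :
    foxHom n (schreierMap n v) = v - sectionDeriv n (foxBoundary n v) := by
  rw [← Finset.univ_sum_single v]
  simp only [map_sum]
  rw [← Finset.sum_sub_distrib]
  refine Finset.sum_congr rfl fun i _ => ?_
  induction v i using MonoidAlgebra.induction_linear with
  | zero => simp
  | add a b ha hb =>
    simp only [Pi.single_add, map_add, ha, hb]
    abel
  | single g m =>
    rw [schreierMap_single, map_zsmul, schreierClass, foxHom_commClass,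
      foxDeriv_mul_inv _ _ (by simp), foxDeriv_mul, foxBoundary_single, mul_sub, mul_one, map_sub]
    have h : (Pi.single i (MonoidAlgebra.single g m) : Fin n → LatticeRing n) =
        m • Pi.single i (MonoidAlgebra.single g 1) := by
      rw [← Pi.single_smul, MonoidAlgebra.smul_single, smul_eq_mul, mul_one]
    rw [h]
    simp only [sectionDeriv, wordElt, freeToLattice_latticeSection, foxDeriv_of,
      MonoidAlgebra.of_apply, MonoidAlgebra.single_mul_single, ← Pi.single_smul, smul_eq_mul,
      mul_one, freeToLattice_of, LinearMap.comp_apply, LinearEquiv.coe_coe,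
      MonoidAlgebra.coeffLinearEquiv_apply, MonoidAlgebra.coeff_single,
      Finsupp.linearCombination_single, smul_sub, smul_add]
    abel

/-- The Fox derivative identifies `[F_n, F_n]^{ab}` with the kernel of the boundary map. -/
noncomputable def commFreeAbEquivKer (n : ℕ) :
    (commFreeAbRep n).asModule ≃ₗ[LatticeRing n] LinearMap.ker (foxBoundary n) := by
  let f : (commFreeAbRep n).asModule →ₗ[LatticeRing n] (Fin n → LatticeRing n) :=
    { toFun := fun x => foxHom n x
      map_add' := fun x y => map_add (foxHom n) x y
      map_smul' := fun r x => by
        change _ = r • foxHom n x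
        induction r using MonoidAlgebra.induction_linear with
        | zero =>
          rw [zero_smul, zero_smul]
          exact map_zero (foxHom n)
        | add a b ha hb =>
          rw [add_smul, add_smul, ← ha, ← hb]
          exact map_add (foxHom n) _ _
        | single g m =>
          rw [Representation.single_smul]
          refine (map_zsmul (foxHom n) m (commFreeAbRep n g x)).trans ?_
          exact smul_foxHom_commFreeAbRep m g x }
  refine LinearEquiv.ofBijective (f.codRestrict _ fun x => ?_) ⟨?_, ?_⟩
  · obtain ⟨w, hw, rfl⟩ := exists_commClass x
    change foxBoundary n (foxDeriv w) = 0
    rw [foxBoundary_foxDeriv, wordElt, hw, map_one, sub_self]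
  · intro x y h
    exact Function.LeftInverse.injective schreierMap_foxHom (congrArg Subtype.val h)
  · rintro ⟨v, hv⟩
    refine ⟨schreierMap n v, Subtype.ext ?_⟩
    change foxHom n (schreierMap n v) = v
    rw [foxHom_schreierMap, hv, map_zero, sub_zero]
end

/-! ### Koszul resolutions as iterated mapping cones -/

section
variable {R : Type} [CommRing R]

/-- The index types of the mapping cone of a multiplication map. -/
def coneIndex (ι : ℕ → Type) : ℕ → Type
  | 0 => ι 0
  | k + 1 => ι (k + 1) ⊕ ι k

instance (ι : ℕ → Type) [∀ k, Fintype (ι k)] : ∀ k, Fintype (coneIndex ι k)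
  | 0 => inferInstanceAs (Fintype (ι 0))
  | k + 1 => inferInstanceAs (Fintype (ι (k + 1) ⊕ ι k))

/-- The differentials of the mapping cone of multiplication by `a`. -/
def coneMap {ι : ℕ → Type} (d : ∀ k, (ι (k + 1) → R) →ₗ[R] (ι k → R)) (a : R) :
    ∀ k, (coneIndex ι (k + 1) → R) →ₗ[R] (coneIndex ι k → R)
  | 0 => d 0 ∘ₗ LinearMap.funLeft R R Sum.inl + a • LinearMap.funLeft R R Sum.inr
  | k + 1 => (LinearEquiv.sumArrowLequivProdArrow _ _ R R).symm.toLinearMap ∘ₗ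
      LinearMap.prod
        (d (k + 1) ∘ₗ LinearMap.funLeft R R Sum.inl + a • LinearMap.funLeft R R Sum.inr)
        (-(d k ∘ₗ LinearMap.funLeft R R Sum.inr))

/-- The element of the mapping cone with given components. -/
def conePair {S : Type} {ι : ℕ → Type} {k : ℕ} (x : ι (k + 1) → S) (y : ι k → S) :
    coneIndex ι (k + 1) → S :=
  Sum.elim x y

lemma exists_conePair {S : Type} {ι : ℕ → Type} (k : ℕ) (v : coneIndex ι (k + 1) → S) :
    ∃ (x : ι (k + 1) → S) (y : ι k → S), v = conePair x y :=
  ⟨v ∘ Sum.inl, v ∘ Sum.inr, (Sum.elim_comp_inl_inr v).symm⟩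

lemma conePair_inj {S : Type} {ι : ℕ → Type} {k : ℕ} {x x' : ι (k + 1) → S} {y y' : ι k → S} :
    conePair x y = conePair x' y' ↔ x = x' ∧ y = y' := by
  constructor
  · intro h
    exact ⟨funext fun i => congrFun h (Sum.inl i), funext fun i => congrFun h (Sum.inr i)⟩
  · rintro ⟨rfl, rfl⟩
    rfl

variable {ι : ℕ → Type} (d : ∀ k, (ι (k + 1) → R) →ₗ[R] (ι k → R)) (a : R)

lemma conePair_eq_zero {k : ℕ} {x : ι (k + 1) → R} {y : ι k → R} :
    conePair x y = 0 ↔ x = 0 ∧ y = 0 := by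
  rw [← conePair_inj]
  have h : conePair (0 : ι (k + 1) → R) (0 : ι k → R) = 0 := by
    funext i
    rcases i with i | i <;> rfl
  rw [h]

lemma coneMap_zero_apply (x : ι 1 → R) (y : ι 0 → R) (i : ι 0) :
    coneMap d a 0 (conePair x y) i = d 0 x i + a * y i := rfl

lemma coneMap_succ_apply (k : ℕ) (x : ι (k + 2) → R) (y : ι (k + 1) → R) :
    coneMap d a (k + 1) (conePair x y) = conePair (d (k + 1) x + a • y) (-d k y) := rfl

/-- The mapping cone of multiplication by a nonzerodivisor on the cokernel is exact. -/
lemma ker_coneMap (hd : ∀ k, LinearMap.ker (d k) = LinearMap.range (d (k + 1)))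
    (ha : ∀ y, a • y ∈ LinearMap.range (d 0) → y ∈ LinearMap.range (d 0)) (k : ℕ) :
    LinearMap.ker (coneMap d a k) = LinearMap.range (coneMap d a (k + 1)) := by
  have hdd : ∀ k x, d k (d (k + 1) x) = 0 := fun k x => (hd k).ge ⟨x, rfl⟩
  apply le_antisymm
  · intro v hv
    obtain ⟨x, y, rfl⟩ := exists_conePair k v
    -- In the lowest degree nothing says that `y` is a cycle; there `ha` makes it a boundary
    -- instead.
    have hy : d k x + a • y = 0 ∧ y ∈ LinearMap.range (d k) := by
      cases k with
      | zero =>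
        have h : d 0 x + a • y = 0 := hv
        refine ⟨h, ha y ⟨-x, ?_⟩⟩
        rw [map_neg, neg_eq_iff_add_eq_zero]
        exact h
      | succ k =>
        have h : coneMap d a (k + 1) (conePair x y) = 0 := hv
        rw [coneMap_succ_apply, conePair_eq_zero] at h
        exact ⟨h.1, (hd k).le (neg_eq_zero.1 h.2)⟩
    obtain ⟨h, z, rfl⟩ := hy
    obtain ⟨w, hw⟩ := (hd k).le (show x + a • z ∈ LinearMap.ker (d k) by simpa using h)
    -- The cone differential sends (w, -z) to (d w - a z, d z), and d w = x + a z.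
    refine ⟨conePair w (-z), ?_⟩
    rw [coneMap_succ_apply, conePair_inj]
    simp [hw]
  · rintro _ ⟨v, rfl⟩
    obtain ⟨x, y, rfl⟩ := exists_conePair (k + 1) v
    rw [LinearMap.mem_ker, coneMap_succ_apply]
    cases k with
    | zero =>
      have h : ∀ i : ι 0, d 0 (d 1 x + a • y) i + a * (-d 0 y) i = 0 := fun i => by simp [hdd]
      exact funext h
    | succ k => rw [coneMap_succ_apply, conePair_eq_zero]; simp [hdd]

/-- The basis elements of degree one in a Koszul complex correspond to the sequence. -/
def coneEquiv {n : ℕ} [Unique (ι 0)] (e : Fin n ≃ ι 1) : Fin (n + 1) ≃ coneIndex ι 1 :=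
  finSumFinEquiv.symm.trans (Equiv.sumCongr e (Equiv.ofUnique (Fin 1) (ι 0)))

lemma conePair_coneEquiv_castSucc {S : Type} {n : ℕ} [Unique (ι 0)] (e : Fin n ≃ ι 1) (x : ι 1 → S)
    (y : ι 0 → S) (j : Fin n) : conePair x y (coneEquiv e j.castSucc) = x (e j) :=
  congrArg (fun s => conePair x y (Equiv.sumCongr e (Equiv.ofUnique (Fin 1) (ι 0)) s))
    (finSumFinEquiv_symm_apply_castAdd j)

lemma conePair_coneEquiv_last {S : Type} {n : ℕ} [Unique (ι 0)] (e : Fin n ≃ ι 1) (x : ι 1 → S)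
    (y : ι 0 → S) (i : ι 0) : conePair x y (coneEquiv e (Fin.last n)) = y i := by
  rw [Unique.eq_default i]
  exact congrArg (fun s => conePair x y (Equiv.sumCongr e (Equiv.ofUnique (Fin 1) (ι 0)) s))
    (finSumFinEquiv_symm_apply_natAdd (0 : Fin 1))

/-- A sequence in which each term is a nonzerodivisor modulo the previous ones has a Koszul
resolution. -/
theorem exists_koszul (a : ℕ → R) (I : Ideal R) (haI : ∀ i, a i ∈ I) (n : ℕ)
    (hreg : ∀ i < n, ∀ r, a i * r ∈ Ideal.span (a '' Set.Iio i) →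
      r ∈ Ideal.span (a '' Set.Iio i)) :
    ∃ (ι : ℕ → Type) (_ : ∀ k, Fintype (ι k)) (_ : Unique (ι 0))
      (d : ∀ k, (ι (k + 1) → R) →ₗ[R] (ι k → R)) (e : Fin n ≃ ι 1),
      (∀ k, LinearMap.ker (d k) = LinearMap.range (d (k + 1))) ∧
      (∀ k, Fintype.card (ι k) = n.choose k) ∧
      (∀ k x i, d k x i ∈ I) ∧
      ∀ v i, d 0 v i = ∑ j, v (e j) * a j := by
  induction n with
  | zero =>
    -- The empty sequence: the ring alone, in degree 0.
    let ι : ℕ → Type := fun | 0 => Unit | _ + 1 => Empty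
    let inst : ∀ k, Fintype (ι k) := fun
      | 0 => inferInstanceAs (Fintype Unit)
      | _ + 1 => inferInstanceAs (Fintype Empty)
    refine ⟨ι, inst, inferInstanceAs (Unique Unit), fun _ => 0, Equiv.equivOfIsEmpty (Fin 0) Empty,
      fun k => ?_, ?_, fun k x i => I.zero_mem, fun v i => by simp⟩
    · ext v
      simp only [LinearMap.ker_zero, Submodule.mem_top, LinearMap.range_zero, Submodule.mem_bot,
        true_iff]
      funext i
      exact Empty.elim i
    · rintro (_ | k)
      · rfl
      · rfl
  | succ n ih =>
    obtain ⟨ι, _, _, d, e, hd, hcard, hI, hd0⟩ := ih fun i hi => hreg i (by omega)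
    refine ⟨coneIndex ι, inferInstance, inferInstanceAs (Unique (ι 0)), coneMap d (a n),
      coneEquiv e, ker_coneMap d (a n) hd ?_, ?_, ?_, ?_⟩
    -- As `ι 0` is a point, the range of `d 0` is the ideal of the first n terms, so the cone
    -- condition is regularity of `a n` modulo that ideal.
    · rintro y ⟨x, hx⟩
      have hs : ∀ v i, d 0 v i ∈ Ideal.span (a '' Set.Iio n) := fun v i => by
        rw [hd0]
        exact Ideal.sum_mem _ fun j _ => Ideal.mul_mem_left _ _
          (Ideal.subset_span ⟨j, j.2, rfl⟩)
      have hy := hreg n (by omega) (y default) (by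
        have := hs x default
        rwa [hx] at this)
      have himg : a '' Set.Iio n = Set.range fun j : Fin n => a j := by
        ext r
        constructor
        · rintro ⟨j, hj, rfl⟩
          exact ⟨⟨j, hj⟩, rfl⟩
        · rintro ⟨j, rfl⟩
          exact ⟨j, j.2, rfl⟩
      rw [himg, Ideal.mem_span_range_iff_exists_fun] at hy
      obtain ⟨c, hc⟩ := hy
      refine ⟨c ∘ e.symm, ?_⟩
      funext i
      rw [hd0, Unique.eq_default i, ← hc]
      simp
    · rintro (_ | k)
      · exact (hcard 0).trans (by simp)
      · change Fintype.card (ι (k + 1) ⊕ ι k) = _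
        rw [Fintype.card_sum, hcard, hcard, Nat.choose_succ_succ, add_comm]
    · rintro (_ | k) v i
      · exact I.add_mem (hI _ _ _) (I.mul_mem_right _ (haI n))
      · rcases i with i | i
        · exact I.add_mem (hI _ _ _) (I.mul_mem_right _ (haI n))
        · exact I.neg_mem (hI _ _ _)
    · intro v i
      obtain ⟨x, y, rfl⟩ := exists_conePair 0 v
      refine (coneMap_zero_apply d (a n) x y i).trans ?_
      refine (congrArg (· + a n * y i) (hd0 x i)).trans ?_
      rw [Fin.sum_univ_castSucc]
      congr 1
      · refine Finset.sum_congr rfl fun j _ => ?_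
        rw [conePair_coneEquiv_castSucc, Fin.val_castSucc]
      · rw [mul_comm, conePair_coneEquiv_last e x y i, Fin.val_last]
end

/-! ### Regularity of the sequence x_i - 1, and the homology computation -/

section
variable {n : ℕ}

/-- The element `x_i - 1` of the group ring, or zero if `i` is out of range. -/
noncomputable def shiftElt (n : ℕ) (i : ℕ) : LatticeRing n :=
  if h : i < n then wordElt (FreeGroup.of ⟨i, h⟩) - 1 else 0

lemma shiftElt_fin (i : Fin n) : shiftElt n i = wordElt (FreeGroup.of i) - 1 := by
  simp [shiftElt]

lemma wordElt_of (i : Fin n) : wordElt (FreeGroup.of i) =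
    MonoidAlgebra.single (Multiplicative.ofAdd (Pi.single i (1 : ℤ))) (1 : ℤ) := by
  simp [wordElt]

/-- The projection of the lattice killing the coordinates below `j`. -/
def latticeProj (n j : ℕ) : IntLattice n →* IntLattice n :=
  AddMonoidHom.toMultiplicative
    { toFun := fun v i => if (i : ℕ) < j then 0 else v i
      map_zero' := by ext; simp
      map_add' := fun v w => by ext i; by_cases h : (i : ℕ) < j <;> simp [h] }

lemma latticeProj_single_of_lt {j : ℕ} {i : Fin n} (h : (i : ℕ) < j) (m : ℤ) :
    latticeProj n j (Multiplicative.ofAdd (Pi.single i m)) = 1 := by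
  apply Multiplicative.toAdd.injective
  ext l
  by_cases hl : l = i
  · subst hl
    simp [latticeProj, h]
  · simp [latticeProj, hl]

lemma latticeProj_single_of_le {j : ℕ} {i : Fin n} (h : j ≤ (i : ℕ)) (m : ℤ) :
    latticeProj n j (Multiplicative.ofAdd (Pi.single i m)) =
      Multiplicative.ofAdd (Pi.single i m) := by
  apply Multiplicative.toAdd.injective
  ext l
  by_cases hl : l = i
  · subst hl
    simp [latticeProj, h.not_gt]
  · simp [latticeProj, hl]

/-- The endomorphism of the group ring setting the first `j` variables to one. -/
noncomputable def ringProj (n j : ℕ) : LatticeRing n →+* LatticeRing n :=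
  MonoidAlgebra.mapDomainRingHom ℤ (latticeProj n j)

lemma ringProj_single (j : ℕ) (g : IntLattice n) (m : ℤ) :
    ringProj n j (MonoidAlgebra.single g m) = MonoidAlgebra.single (latticeProj n j g) m := by
  simp [ringProj]

lemma ringProj_shiftElt_of_lt {i j : ℕ} (h : i < j) : ringProj n j (shiftElt n i) = 0 := by
  unfold shiftElt
  split_ifs with hi
  · rw [map_sub, map_one, wordElt_of, ringProj_single, latticeProj_single_of_lt h,
      ← MonoidAlgebra.one_def, sub_self]
  · simp

lemma ringProj_shiftElt_of_le {i j : ℕ} (h : j ≤ i) :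
    ringProj n j (shiftElt n i) = shiftElt n i := by
  unfold shiftElt
  split_ifs with hi
  · rw [map_sub, map_one, wordElt_of, ringProj_single, latticeProj_single_of_le h]
  · simp

lemma IntLattice.monoidHom_ext {H : Type*} [CommMonoid H] {f g : IntLattice n →* H}
    (h : ∀ i, f (Multiplicative.ofAdd (Pi.single i 1)) = g (Multiplicative.ofAdd (Pi.single i 1))) :
    f = g := by
  have key : f.toHomUnits = g.toHomUnits := by
    apply MonoidHom.toAdditiveRight.injective
    exact AddMonoidHom.functions_ext' _ _ _ fun i =>
      AddMonoidHom.ext_int (congrArg Additive.ofMul (Units.ext (h i)))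
  exact MonoidHom.ext fun v => congrArg Units.val (DFunLike.congr_fun key v)

/-- Both sides are ring homomorphisms, and x_i ≡ 1 modulo the ideal for i < j, so they agree on the
generators. Consequently the kernel of `ringProj n j` is contained in the ideal. -/
lemma mk_ringProj (j : ℕ) (r : LatticeRing n) :
    Ideal.Quotient.mk (Ideal.span (shiftElt n '' Set.Iio j)) (ringProj n j r) =
      Ideal.Quotient.mk (Ideal.span (shiftElt n '' Set.Iio j)) r := by
  suffices h : (Ideal.Quotient.mk (Ideal.span (shiftElt n '' Set.Iio j))).comp (ringProj n j) =
      Ideal.Quotient.mk _ from DFunLike.congr_fun h r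
  apply MonoidAlgebra.ringHom_ext'
  · exact RingHom.ext_int _ _
  · apply IntLattice.monoidHom_ext
    intro i
    change Ideal.Quotient.mk _ (ringProj n j (MonoidAlgebra.single _ 1)) =
      Ideal.Quotient.mk _ (MonoidAlgebra.single _ 1)
    rw [ringProj_single]
    rcases lt_or_ge (i : ℕ) j with h | h
    · rw [latticeProj_single_of_lt h, ← wordElt_of, ← MonoidAlgebra.one_def, eq_comm,
        Ideal.Quotient.eq, ← shiftElt_fin]
      exact Ideal.subset_span ⟨i, h, rfl⟩
    · rw [latticeProj_single_of_le h]

lemma shiftElt_ne_zero {i : ℕ} (h : i < n) : shiftElt n i ≠ 0 := by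
  rw [shiftElt, dif_pos h, wordElt_of, sub_ne_zero, MonoidAlgebra.one_def]
  intro h'
  have := MonoidAlgebra.single_left_injective one_ne_zero h'
  simpa using congrFun (congrArg Multiplicative.toAdd this) ⟨i, h⟩

/-- The elements `x_i - 1` form a regular sequence. -/
lemma mem_span_of_shiftElt_mul_mem {i : ℕ} (hi : i < n) (r : LatticeRing n)
    (hr : shiftElt n i * r ∈ Ideal.span (shiftElt n '' Set.Iio i)) :
    r ∈ Ideal.span (shiftElt n '' Set.Iio i) := by
  have hle : Ideal.span (shiftElt n '' Set.Iio i) ≤ RingHom.ker (ringProj n i) := by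
    rw [Ideal.span_le]
    rintro _ ⟨l, hl, rfl⟩
    exact ringProj_shiftElt_of_lt hl
  have h : ringProj n i (shiftElt n i * r) = 0 := hle hr
  rw [map_mul, ringProj_shiftElt_of_le le_rfl] at h
  -- The group ring of ℤ^n is a domain, so the projection of `r` vanishes; `r` is congruent to its
  -- projection modulo the ideal.
  have h0 := (mul_eq_zero.1 h).resolve_left (shiftElt_ne_zero hi)
  rw [← Ideal.Quotient.eq_zero_iff_mem, ← mk_ringProj, h0, map_zero]

lemma shiftElt_mem_ker_augmentation (i : ℕ) :
    shiftElt n i ∈ RingHom.ker (augmentation (IntLattice n)) := by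
  unfold shiftElt
  split_ifs with h
  · simp [RingHom.mem_ker, wordElt_of]
  · simp

/-- The group homology of the abelianized commutator subgroup. -/
theorem nonempty_groupHomology_commFreeAb (n k : ℕ) :
    Nonempty (groupHomology (Rep.of (commFreeAbRep n)) k ≃ₗ[ℤ] ⋀[ℤ]^(k + 2) (Fin n → ℤ)) := by
  obtain ⟨ι, _, _, d, e, hd, hcard, hI, hd0⟩ := exists_koszul (shiftElt n)
    (RingHom.ker (augmentation (IntLattice n))) shiftElt_mem_ker_augmentation n
    fun i hi r => mem_span_of_shiftElt_mul_mem hi r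
  obtain ⟨E⟩ := nonempty_groupHomology_ker_equiv d hd (fun k x => funext fun i => hI k x i)
    k 0 (k + 2) (by omega)
  -- Reindexing along `e` turns the Fox boundary into the first Koszul differential.
  have hker : (LinearMap.ker (foxBoundary n)).map
      (LinearEquiv.funCongrLeft (LatticeRing n) (LatticeRing n) e.symm : _ →ₗ[LatticeRing n] _) =
      LinearMap.ker (d 0) := by
    ext v
    rw [Submodule.mem_map_equiv, LinearMap.mem_ker, LinearMap.mem_ker, funext_iff]
    have h : foxBoundary n ((LinearEquiv.funCongrLeft (LatticeRing n) (LatticeRing n) e.symm).symm v)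
        = ∑ j, v (e j) * shiftElt n j := by
      simp [foxBoundary, Fintype.linearCombination_apply, shiftElt_fin]
    rw [h]
    refine ⟨fun h i => (hd0 v i).trans h, fun h => (hd0 v default).symm.trans (h default)⟩
  let e1 : (commFreeAbRep n).asModule ≃ₗ[LatticeRing n] LinearMap.ker (d 0) :=
    commFreeAbEquivKer n ≪≫ₗ
      (LinearEquiv.funCongrLeft (LatticeRing n) (LatticeRing n) e.symm).submoduleMap _ ≪≫ₗ
      LinearEquiv.ofEq _ _ hker
  -- Only ranks are compared: both sides are free of rank n.choose (k + 2).
  let e2 : (ι (k + 2) → ℤ) ≃ₗ[ℤ] ⋀[ℤ]^(k + 2) (Fin n → ℤ) := by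
    refine LinearEquiv.ofFinrankEq _ _ ?_
    rw [exteriorPower.finrank_eq, Module.finrank_fintype_fun_eq_card, hcard,
      Module.finrank_fintype_fun_eq_card, Fintype.card_fin]
  exact ⟨((groupHomology.functor ℤ _ k).mapIso (asModuleRepIso (commFreeAbRep n) ≪≫
    modRepIso e1)).toLinearEquiv ≪≫ₗ E ≪≫ₗ e2⟩
end

theorem theoremC (n : ℕ) (hn : 2 ≤ n) :
    (∀ k : ℕ, Nonempty
      (groupHomology (Rep.of (commFreeAbRep n)) k ≃ₗ[ℤ] ⋀[ℤ]^(k + 2) (Fin n → ℤ))) ∧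
    (3 ≤ n → ¬ Module.Free (MonoidAlgebra ℤ (IntLattice n)) (commFreeAbRep n).asModule) := by
  refine ⟨nonempty_groupHomology_commFreeAb n, fun h3 hfree => ?_⟩
  obtain ⟨e⟩ := nonempty_groupHomology_commFreeAb n 1
  have hz : Limits.IsZero (groupHomology (Rep.of (commFreeAbRep n)) 1) :=
    (isZero_groupHomology_of_basis (Module.Free.chooseBasis (MonoidAlgebra ℤ (IntLattice n))
      (commFreeAbRep n).asModule) 0).of_iso
        ((groupHomology.functor ℤ _ 1).mapIso (asModuleRepIso (commFreeAbRep n)))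
  have hs := ModuleCat.subsingleton_of_isZero hz
  have hs' : Subsingleton (⋀[ℤ]^3 (Fin n → ℤ)) := e.symm.toEquiv.subsingleton
  have hr : Module.finrank ℤ (⋀[ℤ]^3 (Fin n → ℤ)) = n.choose 3 := by
    rw [exteriorPower.finrank_eq, Module.finrank_fintype_fun_eq_card, Fintype.card_fin]
  rw [Module.finrank_zero_of_subsingleton] at hr
  exact (Nat.choose_pos h3).ne hr
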